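/- **Setting.** Let $N\ge 1$. For $i=1,\dots,N$ let $n_i,m_i\ge1$, $\Lambda_i^+=\mathrm{diag}(\lambda_i^1,\dots,\lambda_i^{n_i})$, $\Lambda_i^-=\mathrm{diag}(\mu_i^1,\dots,\mu_i^{m_i})$ with $0<\lambda_i^1<\dots<\lambda_i^{n_i}$, $0<\mu_i^1<\dots<\mu_i^{m_i}$, and let $\Sigma_i^{++},\Sigma_i^{+-},\Sigma_i^{-+},\Sigma_i^{--}$ be continuous matrix functions on $[0,1]$, where $\Sigma_i^{++},\Sigma_i^{--}$ have zero diagonal. Let $Q_{i,i},R_{i,i}$, $Q_{i+1,i}\in\mathbb R^{n_{i+1}\times n_i}$ ($i<N$) and $R_{i,i+1}$ be constant matrices, with $R_{N,N+1}=0$ and the convention $v_{N+1}(t,0)\equiv0$. Consider the chain, for $t>0$, $x\in(0,1)$, $$\partial_t u_i+\Lambda_i^+\partial_x u_i=\Sigma_i^{++}(x)u_i+\Sigma_i^{+-}(x)v_i,\qquad \partial_t v_i-\Lambda_i^-\partial_x v_i=\Sigma_i^{-+}(x)u_i+\Sigma_i^{--}(x)v_i,$$ with the boundary conditions, for $t\ge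 0$, $$u_1(t,0)=Q_{1,1}v_1(t,0)+U(t),\qquad u_i(t,0)=Q_{i,i}v_i(t,0)+Q_{i,i-1}u_{i-1}(t,1)\ (i\ge2),\qquad v_i(t,1)=R_{i,i}u_i(t,1)+R_{i,i+1}v_{i+1}(t,0),$$ with an arbitrary input $U$ and the measured output $y(t)=u_N(t,1)$. Solutions are continuous on $[0,\infty)\times[0,1]$ and satisfy the PDEs in the sense of derivatives along the characteristic directions. Assume that $\operatorname{rank}Q_{i,i-1}=n_{i-1}$ for $i=2,\dots,N$. Let $\Lambda_i=\mathrm{diag}(\Lambda_i^+,-\Lambda_i^-)$, $\Sigma_i=\begin{pmatrix}\Sigma_i^{++}&\Sigma_i^{+-}\\ \Sigma_i^{-+}&\Sigma_i^{--}\end{pmatrix}$, and let $K_i=\begin{pmatrix}K_i^{uu}&K_i^{uv}\\K_i^{vu}&K_i^{vv}\end{pmatrix}$ on $\{0\le x\le y\le1\}$, $G_i$ strictly upper triangular on $[0,1]$, and $F_i$ on $\{0\le x\le 1,\ 0\le y\le x/\lambda_i^1\}$ be piecewise continuous and solve (along characteristics) $$\Lambda_i\partial_xK_i+\partial_yK_i\Lambda_i=-K_i\Sigma_i(y)+\begin{pmatrix}G_i(x)&0\\0&0\end{pmatrix}K_i,\quad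 \Lambda_iK_i(x,x)-K_i(x,x)\Lambda_i=\Sigma_i(x)-\begin{pmatrix}G_i(x)&0\\0&0\end{pmatrix},\quad K_i^{uu}(x,1)\Lambda_i^+=K_i^{uv}(x,1)\Lambda_i^-R_{i,i},$$ $$\Lambda_i^+\partial_xF_i+\partial_yF_i=G_i(x)F_i,\quad F_i(x,0)=-K_i^{uv}(x,1)\Lambda_i^-R_{i,i+1},\quad (F_i(x,x/\lambda_i^1))_{k\ell}=0\ (k>1).$$ For $t\ge 1/\lambda_i^1$ put $$\alpha_i(t,x)=u_i(t,x)+\int_0^{x/\lambda_i^1}F_i(x,y)v_{i+1}(t-y,0)\,dy+\int_x^1\big(K_i^{uu}(x,y)u_i(t,y)+K_i^{uv}(x,y)v_i(t,y)\big)dy.$$ Fix $\tau>\sum_{j=1}^N 1/\lambda_j^1$ and write $\bar\gamma(t)=\gamma(t-\tau)$. **Lemma 1.** There are continuous linear operators, depending neither on the solution nor on $U$, that map a measurement signal $y$ to signals $\hat\alpha_i(\cdot,1)$ and $\hat v_{i+1}(\cdot,0)$ on $\mathbb R$, $i=1,\dots,N$ (signals are continuous functions on $\mathbb R$ with locally uniform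 convergence; $y$ is extended to $t<0$ in any continuous way), such that for every $i$: 1. (causality) for all $t\ge0$ and $\nu\in[0,\sum_{j=1}^i1/\lambda_j^1]$, the values $\hat\alpha_i(t+\nu,1)$ and $\hat v_{i+1}(t+\nu,0)$ depend only on $y|_{[0,t]}$; 2. (exactness) for every input $U$ and every solution with output $y$, for all $t\ge 0$ and $\nu\in[0,\sum_{j=1}^i1/\lambda_j^1]$, $$\hat\alpha_i(t+\nu,1)=\bar\alpha_i(t+\nu,1)\quad\text{if } t+\nu\ge\tau+\tfrac1{\lambda_i^1}+\sum_{j=i+1}^N\tfrac1{\mu_j^1},\qquad \hat v_{i+1}(t+\nu,0)=\bar v_{i+1}(t+\nu,0)\quad\text{if } t+\nu\ge\tau+\sum_{j=i+1}^N\tfrac1{\mu_j^1}.$$ Moreover the estimators are given recursively from $i=N$ back to $i=1$: $\hat\alpha_N(s,1)=\bar y(s)$ for $s\ge\tau$ and $\hat v_{N+1}(\cdot,0)=0$, and for $1\le i<N$ there is a continuous linear operator $\Phi_i$ on signals with $(\hat\alpha_i(\cdot,1),\hat v_{i+1}(\cdot,0))=\Phi_i(\hat\alpha_{i+1}(\cdot,1),\hat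 v_{i+2}(\cdot,0))$ for every measurement signal $y$, where the output of $\Phi_i$ at time $s$ depends only on its input up to time $s+1/\lambda_{i+1}^1$. -/

import Mathlib

open Set
open scoped Matrix

noncomputable section

/-- A chain of `N` subsystems of `n i + m i` heterodirectional linear transport equations,
`i = 1, …, N`.  The families are indexed by `ℕ`; only the entries with `1 ≤ i ≤ N` matter (and,
through the zero matrix `Rdown N`, the dimension `m (N + 1)`), the other ones are padding. -/
structure ChainSystem where
  /-- number of subsystems -/
  N : ℕ
  N_pos : 0 < N
  /-- number of rightward (`n`) and leftward (`m`) propagating states -/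
  n : ℕ → ℕ
  m : ℕ → ℕ
  n_pos : ∀ i, 0 < n i
  m_pos : ∀ i, 0 < m i
  /-- transport velocities: `Λ_i^+ = diag (lam i)`, `Λ_i^- = diag (mu i)` -/
  lam : (i : ℕ) → Fin (n i) → ℝ
  mu : (i : ℕ) → Fin (m i) → ℝ
  lam_pos : ∀ i, 1 ≤ i → i ≤ N → ∀ k, 0 < lam i k
  mu_pos : ∀ i, 1 ≤ i → i ≤ N → ∀ k, 0 < mu i k
  lam_strictMono : ∀ i, 1 ≤ i → i ≤ N → StrictMono (lam i)
  mu_strictMono : ∀ i, 1 ≤ i → i ≤ N → StrictMono (mu i)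
  /-- in-domain couplings `Σ_i^{++}, Σ_i^{+-}, Σ_i^{-+}, Σ_i^{--}` -/
  Spp : (i : ℕ) → ℝ → Matrix (Fin (n i)) (Fin (n i)) ℝ
  Spm : (i : ℕ) → ℝ → Matrix (Fin (n i)) (Fin (m i)) ℝ
  Smp : (i : ℕ) → ℝ → Matrix (Fin (m i)) (Fin (n i)) ℝ
  Smm : (i : ℕ) → ℝ → Matrix (Fin (m i)) (Fin (m i)) ℝ
  Spp_cont : ∀ i, 1 ≤ i → i ≤ N → ContinuousOn (Spp i) (Icc 0 1)
  Spm_cont : ∀ i, 1 ≤ i → i ≤ N → ContinuousOn (Spm i) (Icc 0 1)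
  Smp_cont : ∀ i, 1 ≤ i → i ≤ N → ContinuousOn (Smp i) (Icc 0 1)
  Smm_cont : ∀ i, 1 ≤ i → i ≤ N → ContinuousOn (Smm i) (Icc 0 1)
  Spp_diag : ∀ i, 1 ≤ i → i ≤ N → ∀ x ∈ Icc (0 : ℝ) 1, ∀ k, Spp i x k k = 0
  Smm_diag : ∀ i, 1 ≤ i → i ≤ N → ∀ x ∈ Icc (0 : ℝ) 1, ∀ k, Smm i x k k = 0
  /-- `Q i` is `Q_{i,i}`, `Qup i` is `Q_{i+1,i}`, `R i` is `R_{i,i}`, `Rdown i` is `R_{i,i+1}` -/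
  Q : (i : ℕ) → Matrix (Fin (n i)) (Fin (m i)) ℝ
  Qup : (i : ℕ) → Matrix (Fin (n (i + 1))) (Fin (n i)) ℝ
  R : (i : ℕ) → Matrix (Fin (m i)) (Fin (n i)) ℝ
  Rdown : (i : ℕ) → Matrix (Fin (m i)) (Fin (m (i + 1))) ℝ
  /-- the convention `R_{N,N+1} = 0` -/
  Rdown_last : Rdown N = 0

namespace ChainSystem

variable (S : ChainSystem)

/-- The slowest rightward velocity `λ_i^1`. -/
def lam1 (i : ℕ) : ℝ := S.lam i ⟨0, S.n_pos i⟩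

/-- The slowest leftward velocity `μ_i^1`. -/
def mu1 (i : ℕ) : ℝ := S.mu i ⟨0, S.m_pos i⟩

/-- The signal `v_{i+1}(t,0)` that enters subsystem `i` from downstream, with the convention
`v_{N+1}(t,0) = 0`. -/
def vNext (v : (i : ℕ) → ℝ → ℝ → Fin (S.m i) → ℝ) (i : ℕ) (t : ℝ) : Fin (S.m (i + 1)) → ℝ :=
  if i < S.N then v (i + 1) t 0 else 0

/-- `(u, v)` is a solution of the chain on `t ≥ 0`, `x ∈ [0,1]`, with control input `U`.
The states are continuous up to the boundary; `∂_t + λ ∂_x` and `∂_t - μ ∂_x` are the derivatives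
in the directions `(1, λ)` and `(1, -μ)`.  As the right-hand sides are continuous, this is the same
as being a continuous solution in the sense of distributions, and it contains all solutions
in `C⁰([0,∞); H¹) ∩ C¹([0,∞); L²)`. -/
structure IsSolution (U : ℝ → Fin (S.n 1) → ℝ) (u : (i : ℕ) → ℝ → ℝ → Fin (S.n i) → ℝ)
    (v : (i : ℕ) → ℝ → ℝ → Fin (S.m i) → ℝ) : Prop where
  cont_u : ∀ i, 1 ≤ i → i ≤ S.N →
    ContinuousOn (fun p : ℝ × ℝ => u i p.1 p.2) (Ici 0 ×ˢ Icc 0 1)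
  cont_v : ∀ i, 1 ≤ i → i ≤ S.N →
    ContinuousOn (fun p : ℝ × ℝ => v i p.1 p.2) (Ici 0 ×ˢ Icc 0 1)
  pde_u : ∀ i, 1 ≤ i → i ≤ S.N → ∀ t, 0 < t → ∀ x ∈ Ioo (0 : ℝ) 1, ∀ k,
    HasDerivAt (fun s => u i (t + s) (x + S.lam i k * s) k)
      ((S.Spp i x *ᵥ u i t x + S.Spm i x *ᵥ v i t x) k) 0
  pde_v : ∀ i, 1 ≤ i → i ≤ S.N → ∀ t, 0 < t → ∀ x ∈ Ioo (0 : ℝ) 1, ∀ k,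
    HasDerivAt (fun s => v i (t + s) (x - S.mu i k * s) k)
      ((S.Smp i x *ᵥ u i t x + S.Smm i x *ᵥ v i t x) k) 0
  bc_input : ∀ t, 0 ≤ t → u 1 t 0 = S.Q 1 *ᵥ v 1 t 0 + U t
  bc_u : ∀ i, 1 ≤ i → i < S.N → ∀ t, 0 ≤ t →
    u (i + 1) t 0 = S.Q (i + 1) *ᵥ v (i + 1) t 0 + S.Qup i *ᵥ u i t 1
  bc_v : ∀ i, 1 ≤ i → i ≤ S.N → ∀ t, 0 ≤ t →
    v i t 1 = S.R i *ᵥ u i t 1 + S.Rdown i *ᵥ S.vNext v i t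

end ChainSystem

/-- Piecewise continuity on `D`: finitely many convex pieces cover `D`, and on each of them `f`
coincides with a function that is continuous on the whole space. -/
def PiecewiseContinuousOn {E : Type*} [TopologicalSpace E] [AddCommGroup E] [Module ℝ E]
    (f : E → ℝ) (D : Set E) : Prop :=
  ∃ (r : ℕ) (P : Fin r → Set E) (g : Fin r → E → ℝ),
    (∀ j, Convex ℝ (P j)) ∧ (∀ j, Continuous (g j)) ∧ D ⊆ ⋃ j, P j ∧
      ∀ j, ∀ z ∈ D ∩ P j, f z = g j z

namespace ChainSystem

variable (S : ChainSystem)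

/-- Index set of the full state `(u_i, v_i)` of subsystem `i`. -/
abbrev Idx (i : ℕ) : Type := Fin (S.n i) ⊕ Fin (S.m i)

/-- Diagonal of `Λ_i = diag (Λ_i^+, -Λ_i^-)`. -/
def speed (i : ℕ) : S.Idx i → ℝ := Sum.elim (S.lam i) (fun k => -S.mu i k)

/-- The full in-domain coupling matrix `Σ_i`. -/
def Sig (i : ℕ) (x : ℝ) : Matrix (S.Idx i) (S.Idx i) ℝ :=
  Matrix.fromBlocks (S.Spp i x) (S.Spm i x) (S.Smp i x) (S.Smm i x)

/-- Kernels of the time-affine backstepping transformation: `K i = (K^{uu} K^{uv}; K^{vu} K^{vv})`,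
the time-affine kernel `F i`, and the residual coupling `G i`. -/
structure Kernels where
  K : (i : ℕ) → ℝ → ℝ → Matrix (S.Idx i) (S.Idx i) ℝ
  F : (i : ℕ) → ℝ → ℝ → Matrix (Fin (S.n i)) (Fin (S.m (i + 1))) ℝ
  G : (i : ℕ) → ℝ → Matrix (Fin (S.n i)) (Fin (S.n i)) ℝ

/-- Domain of `K i`. -/
def triK : Set (ℝ × ℝ) := {p | 0 ≤ p.1 ∧ p.1 ≤ p.2 ∧ p.2 ≤ 1}

/-- Domain of `F i`. -/
def triF (i : ℕ) : Set (ℝ × ℝ) := {p | p.1 ∈ Icc (0 : ℝ) 1 ∧ 0 ≤ p.2 ∧ p.2 ≤ p.1 / S.lam1 i}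

/-- The matrix `diag (G_i(x), 0)`. -/
def Kernels.Gfull {S : ChainSystem} (κ : S.Kernels) (i : ℕ) (x : ℝ) :
    Matrix (S.Idx i) (S.Idx i) ℝ :=
  Matrix.fromBlocks (κ.G i x) 0 0 0

/-- The kernel equations of subsystem `i`.  The kernels are piecewise continuous only, so their
transport equations `Λ ∂ₓK + ∂_yK Λ = -K Σ(y) + diag(G,0) K` and `Λ⁺ ∂ₓF + ∂_yF = G F` are
integrated along the characteristic lines of each entry.  Where the data of two edges clash, which
is at a corner of the domain only, the value of one of them is taken.  The entries of `K^{vv}`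
whose remaining edge data are arbitrary are not constrained there. -/
structure Kernels.IsBackstepping {S : ChainSystem} (κ : S.Kernels) (i : ℕ) : Prop where
  pc_K : ∀ p q, PiecewiseContinuousOn (fun z : ℝ × ℝ => κ.K i z.1 z.2 p q) triK
  pc_F : ∀ k l, PiecewiseContinuousOn (fun z : ℝ × ℝ => κ.F i z.1 z.2 k l) (S.triF i)
  pc_G : ∀ k l, PiecewiseContinuousOn (fun x : ℝ => κ.G i x k l) (Icc 0 1)
  /-- `G` is strictly upper triangular -/
  G_upper : ∀ x ∈ Icc (0 : ℝ) 1, ∀ k l, l ≤ k → κ.G i x k l = 0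
  K_pde : ∀ p q, ∀ x y h : ℝ, 0 ≤ h →
    (∀ s ∈ Icc 0 h, (x + S.speed i p * s, y + S.speed i q * s) ∈ triK) →
    κ.K i (x + S.speed i p * h) (y + S.speed i q * h) p q = κ.K i x y p q +
      ∫ s in (0 : ℝ)..h,
        (-(κ.K i (x + S.speed i p * s) (y + S.speed i q * s) * S.Sig i (y + S.speed i q * s)) +
          κ.Gfull i (x + S.speed i p * s) *
            κ.K i (x + S.speed i p * s) (y + S.speed i q * s)) p q
  K_diag : ∀ x ∈ Icc (0 : ℝ) 1,
    Matrix.diagonal (S.speed i) * κ.K i x x - κ.K i x x * Matrix.diagonal (S.speed i) =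
      S.Sig i x - κ.Gfull i x
  K_right : ∀ k l, ∀ x ∈ Icc (0 : ℝ) 1, (x < 1 ∨ k ≤ l) →
    ((κ.K i x 1).toBlocks₁₁ * Matrix.diagonal (S.lam i)) k l =
      ((κ.K i x 1).toBlocks₁₂ * Matrix.diagonal (S.mu i) * S.R i) k l
  F_pde : ∀ k l, ∀ x y h : ℝ, 0 ≤ h →
    (∀ s ∈ Icc 0 h, (x + S.lam i k * s, y + s) ∈ S.triF i) →
    κ.F i (x + S.lam i k * h) (y + h) k l = κ.F i x y k l +
      ∫ s in (0 : ℝ)..h, (κ.G i (x + S.lam i k * s) * κ.F i (x + S.lam i k * s) (y + s)) k l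
  F_bottom : ∀ x ∈ Icc (0 : ℝ) 1,
    κ.F i x 0 = -((κ.K i x 1).toBlocks₁₂ * Matrix.diagonal (S.mu i) * S.Rdown i)
  F_hyp : ∀ x ∈ Ioc (0 : ℝ) 1, ∀ (k : Fin (S.n i)) (l : Fin (S.m (i + 1))), 0 < k.val →
    κ.F i x (x / S.lam1 i) k l = 0

/-- The transformed rightward state `α_i(t,x)` (meaningful for `t ≥ 1 / λ_i^1`). -/
def Kernels.alpha {S : ChainSystem} (κ : S.Kernels) (u : (i : ℕ) → ℝ → ℝ → Fin (S.n i) → ℝ)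
    (v : (i : ℕ) → ℝ → ℝ → Fin (S.m i) → ℝ) (i : ℕ) (t x : ℝ) : Fin (S.n i) → ℝ :=
  u i t x + (∫ y in (0 : ℝ)..(x / S.lam1 i), κ.F i x y *ᵥ S.vNext v i (t - y)) +
    ∫ y in x..1, ((κ.K i x y).toBlocks₁₁ *ᵥ u i t y + (κ.K i x y).toBlocks₁₂ *ᵥ v i t y)

end ChainSystem

/-- The `τ`-delay operator. -/
def delayed {E : Type*} (τ : ℝ) (γ : ℝ → E) : ℝ → E := fun t => γ (t - τ)

/-- Continuous `ℝ^k`-valued signals, with locally uniform convergence. -/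
abbrev Signal (k : ℕ) : Type := C(ℝ, Fin k → ℝ)

/-- The values of the output signal at the times `t + ν`, `0 ≤ ν ≤ w`, are determined by the
measurement on `[0, t]`: the estimate is known at time `t` on the window `[t, t + w]`. -/
def CausalOnWindow {p q : ℕ} (A : Signal p → Signal q) (w : ℝ) : Prop :=
  ∀ t, 0 ≤ t → ∀ y y' : Signal p, (∀ s ∈ Icc 0 t, y s = y' s) →
    ∀ ν ∈ Icc 0 w, A y (t + ν) = A y' (t + ν)

/-- The output signals at time `s` only depend on the input signals up to time `s + h`. -/
def HasLookahead {p p' q q' : ℕ} (Φ : Signal p × Signal p' → Signal q × Signal q') (h : ℝ) :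
    Prop :=
  ∀ s, ∀ a a' : Signal p, ∀ b b' : Signal p', (∀ r ≤ s + h, a r = a' r ∧ b r = b' r) →
    (Φ (a, b)).1 s = (Φ (a', b')).1 s ∧ (Φ (a, b)).2 s = (Φ (a', b')).2 s

end

/-! No transport speed vanishes, so the lines x = const are non-characteristic and each subsystem
can be solved in the direction of decreasing x, with t as the transverse variable. Cauchy data
u(·,1), v(·,1) thus determine the state at x = 0. At time s this state depends on data between s -
1/μ¹ and s + 1/λ¹: the lower end costs exactness after a start-up time, the upper end costs
anticipation. The flow `charFlow` is a Picard series, linear and continuous in the data.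
`charFlow_congr` is its domain of dependence, and `charFlow_eq_of_integral_eq` identifies it with
actual solutions.

One step of the recursion (`exists_recursion_step`) goes from α_{i+1}(·,1), v_{i+2}(·,0) to
α_i(·,1), v_{i+1}(·,0). At x = 1 the integral with K is empty, so α - u is a causal convolution of
the downstream signal with F(1,·). Subtracting it gives u_{i+1}(·,1), and the boundary condition
gives v_{i+1}(·,1). The flow then gives both states at x = 0, a left inverse of Q_{i+1,i} extracts
u_i(·,1) from the coupling condition, and adding the convolution for subsystem i gives α_i(·,1).

The convolution has memory 1/λ¹, which would delay exactness in every step if true values of v were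
demanded in it. `Tracks` therefore takes the convolution of the estimate itself: the next step
subtracts exactly that term, so early errors cancel. Only the final comparison with α_i pays 1/λ_i¹,
once (`Tracks.fst_eq_alpha`).

The lookaheads from N down to i add up to ∑_{j>i} 1/λ_j¹, and the prediction window is ∑_{j≤i}
1/λ_j¹. Their sum is less than the delay τ, hence causality. The losses 1/μ_j¹, j > i, add up to the
start-up time. -/

noncomputable section

open MeasureTheory Filter Topology

/-! ### Evolution along characteristics in the spatial variable: Picard series and domain of
dependence. -/

section CharacteristicFlow

variable {ι : Type*} [Fintype ι]

/-- The integral of `B w` along the characteristic with slope `d p` that ends in `(ξ, t)`. -/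
def charInt (d : ι → ℝ) (B : ℝ → Matrix ι ι ℝ) (w : ℝ → ℝ → ι → ℝ) (ξ t : ℝ) : ι → ℝ :=
  fun p => ∫ η in (0 : ℝ)..ξ, (B η *ᵥ w η (t + d p * (ξ - η))) p

/-- The terms of the Picard series of `w = g ∘ (characteristics) + charInt d B w`. -/
def picardTerm (d : ι → ℝ) (B : ℝ → Matrix ι ι ℝ) (g : ℝ → ι → ℝ) : ℕ → ℝ → ℝ → ι → ℝ
  | 0 => fun ξ t p => g (t + d p * ξ) p
  | k + 1 => charInt d B (picardTerm d B g k)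

/-- Sets of points `(ξ, t)`, `0 ≤ ξ ≤ 1`, that contain all characteristics running back to `ξ = 0`
from their points. -/
def CharClosed (d : ι → ℝ) (D : Set (ℝ × ℝ)) : Prop :=
  ∀ ξ t, (ξ, t) ∈ D → 0 ≤ ξ ∧ ξ ≤ 1 ∧ ∀ p, ∀ η ∈ Icc 0 ξ, (η, t + d p * (ξ - η)) ∈ D

theorem exists_mulVec_bound {B : ℝ → Matrix ι ι ℝ} (hB : Continuous B) :
    ∃ M : ℝ, 0 < M ∧ ∀ η ∈ Icc (0 : ℝ) 1, ∀ x : ι → ℝ, ‖B η *ᵥ x‖ ≤ M * ‖x‖ := by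
  have hc : Continuous fun η => ∑ p, ∑ q, |B η p q| := by
    refine continuous_finsetSum _ fun p _ => continuous_finsetSum _ fun q _ => ?_
    exact (hB.matrix_elem p q).abs
  obtain ⟨M, hM⟩ := (isCompact_Icc (a := (0 : ℝ)) (b := 1)).bddAbove_image hc.continuousOn
  refine ⟨max M 1, by positivity, fun η hη x => ?_⟩
  have h1 : ∑ p, ∑ q, |B η p q| ≤ max M 1 :=
    (hM (mem_image_of_mem _ hη)).trans (le_max_left _ _)
  refine (pi_norm_le_iff_of_nonneg (by positivity)).2 fun p => ?_
  calc ‖(B η *ᵥ x) p‖ ≤ ∑ q, |B η p q| * ‖x‖ := by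
        refine (norm_sum_le _ _).trans (Finset.sum_le_sum fun q _ => ?_)
        rw [norm_mul, Real.norm_eq_abs]
        exact mul_le_mul_of_nonneg_left (norm_le_pi_norm x q) (abs_nonneg _)
    _ = (∑ q, |B η p q|) * ‖x‖ := (Finset.sum_mul ..).symm
    _ ≤ max M 1 * ‖x‖ := by
        refine mul_le_mul_of_nonneg_right (le_trans ?_ h1) (norm_nonneg _)
        exact Finset.single_le_sum (f := fun p => ∑ q, |B η p q|)
          (fun p _ => Finset.sum_nonneg fun q _ => abs_nonneg _) (Finset.mem_univ p)

/-- The weight exp(2Mξ) grows at twice the rate bounding B, so integration gains a factor 1/2. Hence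
the Picard iteration contracts on all of 0 ≤ ξ ≤ 1 without a smallness condition. Closedness of D
keeps the estimate local to a domain of dependence. -/
theorem norm_charInt_le {d : ι → ℝ} {B : ℝ → Matrix ι ι ℝ} {D : Set (ℝ × ℝ)}
    (hD : CharClosed d D) {M : ℝ} (hM : 0 < M)
    (hB : ∀ η ∈ Icc (0 : ℝ) 1, ∀ x : ι → ℝ, ‖B η *ᵥ x‖ ≤ M * ‖x‖)
    {w : ℝ → ℝ → ι → ℝ} {C : ℝ} (hC : 0 ≤ C)
    (hw : ∀ ξ t, (ξ, t) ∈ D → ‖w ξ t‖ ≤ C * Real.exp (2 * M * ξ))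
    {ξ t : ℝ} (h : (ξ, t) ∈ D) :
    ‖charInt d B w ξ t‖ ≤ C / 2 * Real.exp (2 * M * ξ) := by
  obtain ⟨h0, h1, hch⟩ := hD ξ t h
  refine (pi_norm_le_iff_of_nonneg (by positivity)).2 fun p => ?_
  have hint : ∫ η in (0 : ℝ)..ξ, M * (C * Real.exp (2 * M * η)) =
      C / 2 * (Real.exp (2 * M * ξ) - 1) := by
    have := intervalIntegral.integral_eq_sub_of_hasDerivAt (a := 0) (b := ξ)
      (f := fun η => C / 2 * Real.exp (2 * M * η))
      (f' := fun η => M * (C * Real.exp (2 * M * η)))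
      (fun η _ => by
        have h := (((hasDerivAt_id η).const_mul (2 * M)).exp).const_mul (C / 2)
        exact h.congr_deriv (by simp only [id]; ring))
      (Continuous.intervalIntegrable (by fun_prop) _ _)
    rw [this]; simp; ring
  have hle : ‖charInt d B w ξ t p‖ ≤ ∫ η in (0 : ℝ)..ξ, M * (C * Real.exp (2 * M * η)) := by
    refine intervalIntegral.norm_integral_le_of_norm_le h0 (Eventually.of_forall fun η hη => ?_)
      (Continuous.intervalIntegrable (by fun_prop) _ _)
    have hη' : η ∈ Icc 0 ξ := ⟨hη.1.le, hη.2⟩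
    refine (norm_le_pi_norm _ p).trans ((hB η ⟨hη.1.le, hη.2.trans h1⟩ _).trans ?_)
    exact mul_le_mul_of_nonneg_left (hw _ _ (hch p η hη')) hM.le
  rw [hint] at hle
  refine hle.trans ?_
  have : 0 ≤ C / 2 := by positivity
  nlinarith

theorem norm_picardTerm_le {d : ι → ℝ} {B : ℝ → Matrix ι ι ℝ} {D : Set (ℝ × ℝ)}
    (hD : CharClosed d D) {M : ℝ} (hM : 0 < M)
    (hB : ∀ η ∈ Icc (0 : ℝ) 1, ∀ x : ι → ℝ, ‖B η *ᵥ x‖ ≤ M * ‖x‖)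
    {g : ℝ → ι → ℝ} {C : ℝ} (hC : 0 ≤ C) (hg : ∀ s, (0, s) ∈ D → ‖g s‖ ≤ C)
    (k : ℕ) {ξ t : ℝ} (h : (ξ, t) ∈ D) :
    ‖picardTerm d B g k ξ t‖ ≤ C * (1 / 2) ^ k * Real.exp (2 * M * ξ) := by
  induction k generalizing ξ t with
  | zero =>
    obtain ⟨h0, h1, hch⟩ := hD ξ t h
    have hexp : 1 ≤ Real.exp (2 * M * ξ) := Real.one_le_exp (by positivity)
    refine (pi_norm_le_iff_of_nonneg (by positivity)).2 fun p => ?_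
    have hp := hch p 0 ⟨le_rfl, h0⟩
    rw [sub_zero] at hp
    calc ‖g (t + d p * ξ) p‖ ≤ C := (norm_le_pi_norm _ p).trans (hg _ hp)
      _ ≤ C * (1 / 2) ^ 0 * Real.exp (2 * M * ξ) := by
        rw [pow_zero, mul_one]; exact le_mul_of_one_le_right hC hexp
  | succ k ih =>
    refine (norm_charInt_le hD hM hB (by positivity) (fun ξ t h => ih h) h).trans_eq ?_
    ring

theorem continuous_charInt {d : ι → ℝ} {B : ℝ → Matrix ι ι ℝ} (hB : Continuous B)
    {X : Type*} [TopologicalSpace X] {w : X → ℝ → ℝ → ι → ℝ}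
    (hw : Continuous fun z : X × ℝ × ℝ => w z.1 z.2.1 z.2.2) :
    Continuous fun z : X × ℝ × ℝ => charInt d B (w z.1) z.2.1 z.2.2 := by
  refine continuous_pi fun p => ?_
  refine intervalIntegral.continuous_parametric_intervalIntegral_of_continuous
    (f := fun (z : X × ℝ × ℝ) η => (B η *ᵥ w z.1 η (z.2.2 + d p * (z.2.1 - η))) p) ?_
    (continuous_fst.comp continuous_snd)
  have h1 : Continuous fun z : (X × ℝ × ℝ) × ℝ =>
      w z.1.1 z.2 (z.1.2.2 + d p * (z.1.2.1 - z.2)) :=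
    hw.comp (f := fun z : (X × ℝ × ℝ) × ℝ => (z.1.1, z.2, z.1.2.2 + d p * (z.1.2.1 - z.2)))
      (by fun_prop)
  exact (continuous_apply p).comp ((hB.comp continuous_snd).matrix_mulVec h1)

/-- Continuity is joint in the data and the point, because continuity of a map into signals is
obtained by currying. -/
theorem continuous_picardTerm {d : ι → ℝ} {B : ℝ → Matrix ι ι ℝ} (hB : Continuous B) (k : ℕ) :
    Continuous fun z : C(ℝ, ι → ℝ) × ℝ × ℝ => picardTerm d B z.1 k z.2.1 z.2.2 := by
  induction k with
  | zero =>
    refine continuous_pi fun p => ?_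
    have : Continuous fun z : C(ℝ, ι → ℝ) × ℝ × ℝ => z.1 (z.2.2 + d p * z.2.1) := by fun_prop
    exact (continuous_apply p).comp this
  | succ k ih =>
    exact continuous_charInt hB (w := fun g : C(ℝ, ι → ℝ) => picardTerm d B g k) ih

theorem continuous_picardTerm_apply {d : ι → ℝ} {B : ℝ → Matrix ι ι ℝ} (hB : Continuous B)
    (g : C(ℝ, ι → ℝ)) (k : ℕ) :
    Continuous fun z : ℝ × ℝ => picardTerm d B g k z.1 z.2 :=
  (continuous_picardTerm hB k).comp (Continuous.prodMk_right g)

theorem continuous_charInt_integrand {d : ι → ℝ} {B : ℝ → Matrix ι ι ℝ} (hB : Continuous B)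
    {w : ℝ → ℝ → ι → ℝ} (hw : Continuous fun z : ℝ × ℝ => w z.1 z.2) (ξ t : ℝ) (p : ι) :
    Continuous fun η => (B η *ᵥ w η (t + d p * (ξ - η))) p := by
  have h1 : Continuous fun η => w η (t + d p * (ξ - η)) :=
    hw.comp (f := fun η => (η, t + d p * (ξ - η))) (by fun_prop)
  exact (continuous_apply p).comp (hB.matrix_mulVec h1)

theorem picardTerm_add {d : ι → ℝ} {B : ℝ → Matrix ι ι ℝ} (hB : Continuous B)
    (g g' : C(ℝ, ι → ℝ)) (k : ℕ) (ξ t : ℝ) :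
    picardTerm d B (g + g' : C(ℝ, ι → ℝ)) k ξ t =
      picardTerm d B g k ξ t + picardTerm d B g' k ξ t := by
  induction k generalizing ξ t with
  | zero => rfl
  | succ k ih =>
    funext p
    simp only [picardTerm, charInt, Pi.add_apply]
    rw [← intervalIntegral.integral_add]
    · simp only [ih, Matrix.mulVec_add, Pi.add_apply]
    · exact (continuous_charInt_integrand hB (continuous_picardTerm_apply hB g k) ξ t
        p).intervalIntegrable _ _
    · exact (continuous_charInt_integrand hB (continuous_picardTerm_apply hB g' k) ξ t
        p).intervalIntegrable _ _

theorem picardTerm_smul {d : ι → ℝ} {B : ℝ → Matrix ι ι ℝ}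
    (c : ℝ) (g : C(ℝ, ι → ℝ)) (k : ℕ) (ξ t : ℝ) :
    picardTerm d B (c • g : C(ℝ, ι → ℝ)) k ξ t = c • picardTerm d B g k ξ t := by
  induction k generalizing ξ t with
  | zero => rfl
  | succ k ih =>
    funext p
    change (∫ η in (0 : ℝ)..ξ, _) = c * ∫ η in (0 : ℝ)..ξ, _
    rw [← intervalIntegral.integral_const_mul]
    simp only [ih, Matrix.mulVec_smul, Pi.smul_apply, smul_eq_mul]

/-- The points at which the flow is determined by data on `[-L, L]`. -/
def slopeCone (d : ι → ℝ) (L : ℝ) : Set (ℝ × ℝ) :=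
  {z | 0 ≤ z.1 ∧ z.1 ≤ 1 ∧ |z.2| + (∑ p, |d p|) * z.1 ≤ L}

/-- The sum of all |d p| dominates every slope, so the time shift along a characteristic is absorbed
by the narrowing of the cone. -/
theorem charClosed_slopeCone (d : ι → ℝ) (L : ℝ) : CharClosed d (slopeCone d L) := by
  rintro ξ t ⟨h0, h1, h2⟩
  refine ⟨h0, h1, fun p η hη => ⟨hη.1, hη.2.trans h1, ?_⟩⟩
  have hp : |d p| ≤ ∑ p, |d p| :=
    Finset.single_le_sum (f := fun p => |d p|) (fun p _ => abs_nonneg _) (Finset.mem_univ p)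
  have h3 : |t + d p * (ξ - η)| ≤ |t| + |d p| * (ξ - η) := by
    refine (abs_add_le _ _).trans_eq ?_
    rw [abs_mul, abs_of_nonneg (sub_nonneg.2 hη.2)]
  have h4 : |d p| * (ξ - η) ≤ (∑ p, |d p|) * (ξ - η) :=
    mul_le_mul_of_nonneg_right hp (sub_nonneg.2 hη.2)
  dsimp only at h2 ⊢
  linarith [mul_sub (∑ p, |d p|) ξ η]

theorem exists_bound_Icc (g : C(ℝ, ι → ℝ)) (L : ℝ) :
    ∃ C, 0 < C ∧ ∀ s ∈ Icc (-L) L, ‖g s‖ < C := by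
  obtain ⟨C, hC⟩ := (isCompact_Icc (a := -L) (b := L)).bddAbove_image
    (f := fun s => ‖g s‖) (by fun_prop)
  refine ⟨max C 0 + 1, by positivity, fun s hs => ?_⟩
  have := hC (mem_image_of_mem _ hs)
  have := le_max_left C 0
  linarith

theorem norm_picardTerm_one_le {d : ι → ℝ} {B : ℝ → Matrix ι ι ℝ} {M : ℝ} (hM : 0 < M)
    (hB : ∀ η ∈ Icc (0 : ℝ) 1, ∀ x : ι → ℝ, ‖B η *ᵥ x‖ ≤ M * ‖x‖)
    {g : ℝ → ι → ℝ} {C L : ℝ} (hC : 0 ≤ C) (hg : ∀ s ∈ Icc (-L) L, ‖g s‖ ≤ C)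
    {t : ℝ} (ht : |t| + ∑ p, |d p| ≤ L) (k : ℕ) :
    ‖picardTerm d B g k 1 t‖ ≤ C * (1 / 2) ^ k * Real.exp (2 * M * 1) := by
  refine norm_picardTerm_le (charClosed_slopeCone d L) hM hB hC (fun s hs => hg s ?_) k
    ⟨zero_le_one, le_rfl, by simpa using ht⟩
  have := hs.2.2
  simp only [mul_zero, add_zero] at this
  exact abs_le.1 this

theorem summable_geometric_mul (C K : ℝ) : Summable fun k : ℕ => C * (1 / 2 : ℝ) ^ k * K :=
  (summable_geometric_two.mul_left C).mul_right K

theorem summable_picardTerm {d : ι → ℝ} {B : ℝ → Matrix ι ι ℝ} (hB : Continuous B)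
    (g : C(ℝ, ι → ℝ)) (t : ℝ) : Summable fun k => picardTerm d B g k 1 t := by
  obtain ⟨M, hM, hBM⟩ := exists_mulVec_bound hB
  obtain ⟨C, hC, hg⟩ := exists_bound_Icc g (|t| + ∑ p, |d p|)
  exact Summable.of_norm_bounded (summable_geometric_mul C (Real.exp (2 * M * 1)))
    (norm_picardTerm_one_le hM hBM hC.le (fun s hs => (hg s hs).le) le_rfl)

theorem continuous_tsum_picardTerm (d : ι → ℝ) {B : ℝ → Matrix ι ι ℝ} (hB : Continuous B) :
    Continuous fun z : C(ℝ, ι → ℝ) × ℝ => ∑' k, picardTerm d B z.1 k 1 z.2 := by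
  obtain ⟨M, hM, hBM⟩ := exists_mulVec_bound hB
  refine continuous_iff_continuousAt.2 fun ⟨g₀, t₀⟩ => ?_
  set L := |t₀| + 1 + ∑ p, |d p| with hL
  obtain ⟨C, hC, hg⟩ := exists_bound_Icc g₀ L
  -- The bound on [-L, L] is an open condition in the compact-open topology. It gives one geometric
  -- majorant for all data and times near the given point.
  let W : Set (C(ℝ, ι → ℝ) × ℝ) :=
    {g : C(ℝ, ι → ℝ) | MapsTo g (Icc (-L) L) (Metric.ball 0 C)} ×ˢ Metric.ball t₀ 1
  have hW : W ∈ 𝓝 (g₀, t₀) := by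
    refine prod_mem_nhds ?_ (Metric.ball_mem_nhds _ one_pos)
    exact (ContinuousMap.isOpen_setOfPred_mapsTo isCompact_Icc Metric.isOpen_ball).mem_nhds
      fun s hs => by simpa using hg s hs
  refine ContinuousOn.continuousAt (s := W) ?_ hW
  refine continuousOn_tsum (fun k => ?_) (summable_geometric_mul C (Real.exp (2 * M * 1)))
    fun k z hz => norm_picardTerm_one_le hM hBM hC.le (L := L)
      (fun s hs => (mem_ball_zero_iff.1 (hz.1 hs)).le) ?_ k
  · exact ((continuous_picardTerm hB k).comp
      (f := fun z : C(ℝ, ι → ℝ) × ℝ => (z.1, (1 : ℝ), z.2)) (by fun_prop)).continuousOn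
  · have h1 : |z.2 - t₀| < 1 := by simpa [Real.dist_eq] using hz.2
    have h2 := abs_sub_abs_le_abs_sub z.2 t₀
    linarith

/-- A continuous linear map into signals, from a jointly continuous family of functionals. -/
def signalCLM {E F : Type*} [AddCommGroup E] [Module ℝ E] [TopologicalSpace E]
    [NormedAddCommGroup F] [NormedSpace ℝ F] (f : E → ℝ → F)
    (hadd : ∀ x y t, f (x + y) t = f x t + f y t) (hsmul : ∀ (c : ℝ) x t, f (c • x) t = c • f x t)
    (hf : Continuous fun z : E × ℝ => f z.1 z.2) : E →L[ℝ] C(ℝ, F) where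
  toFun x := ⟨f x, hf.comp (Continuous.prodMk_right x)⟩
  map_add' x y := ContinuousMap.ext fun t => hadd x y t
  map_smul' c x := ContinuousMap.ext fun t => hsmul c x t
  cont := ContinuousMap.continuous_of_continuous_uncurry _ hf

/-- The value at `ξ = 1` of the solution with data `g` at `ξ = 0` of the system with slopes `d`
and coupling `B`, as a function of time. -/
def charFlow (d : ι → ℝ) {B : ℝ → Matrix ι ι ℝ} (hB : Continuous B) :
    C(ℝ, ι → ℝ) →L[ℝ] C(ℝ, ι → ℝ) :=
  signalCLM (fun g t => ∑' k, picardTerm d B g k 1 t)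
    (fun g g' t => by
      simp only [picardTerm_add hB]
      exact (summable_picardTerm hB g t).tsum_add (summable_picardTerm hB g' t))
    (fun c g t => by simp only [picardTerm_smul]; exact tsum_const_smul'' c)
    (continuous_tsum_picardTerm d hB)

theorem charFlow_apply (d : ι → ℝ) {B : ℝ → Matrix ι ι ℝ} (hB : Continuous B)
    (g : C(ℝ, ι → ℝ)) (t : ℝ) : charFlow d hB g t = ∑' k, picardTerm d B g k 1 t := rfl

/-- Domain of dependence of the flow. -/
theorem charFlow_eq_zero {d : ι → ℝ} {B : ℝ → Matrix ι ι ℝ} (hB : Continuous B)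
    {D : Set (ℝ × ℝ)} (hD : CharClosed d D) {g : C(ℝ, ι → ℝ)}
    (hg : ∀ s, (0, s) ∈ D → g s = 0) {t : ℝ} (ht : (1, t) ∈ D) : charFlow d hB g t = 0 := by
  obtain ⟨M, hM, hBM⟩ := exists_mulVec_bound hB
  rw [charFlow_apply]
  have : ∀ k, picardTerm d B g k 1 t = 0 := fun k => by
    have := norm_picardTerm_le hD hM hBM le_rfl (g := g) (fun s hs => (by simp [hg s hs])) k ht
    simpa using this
  simp [this]

theorem charFlow_congr {d : ι → ℝ} {B : ℝ → Matrix ι ι ℝ} (hB : Continuous B)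
    {D : Set (ℝ × ℝ)} (hD : CharClosed d D) {g g' : C(ℝ, ι → ℝ)}
    (hg : ∀ s, (0, s) ∈ D → g s = g' s) {t : ℝ} (ht : (1, t) ∈ D) :
    charFlow d hB g t = charFlow d hB g' t := by
  have := charFlow_eq_zero hB hD (g := g - g') (fun s hs => by simp [hg s hs]) ht
  rw [map_sub] at this
  exact sub_eq_zero.1 this

/-- A bounded solution of the integral equation on a domain of dependence is given by the flow. -/
theorem charFlow_eq_of_integral_eq {d : ι → ℝ} {B : ℝ → Matrix ι ι ℝ} (hB : Continuous B)
    {D : Set (ℝ × ℝ)} (hD : CharClosed d D) {g : C(ℝ, ι → ℝ)} {w : ℝ → ℝ → ι → ℝ} {C : ℝ}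
    (hbd : ∀ ξ t, (ξ, t) ∈ D → ‖w ξ t‖ ≤ C)
    (hint : ∀ ξ t, (ξ, t) ∈ D → ∀ p,
      IntervalIntegrable (fun η => (B η *ᵥ w η (t + d p * (ξ - η))) p) volume 0 ξ)
    (heq : ∀ ξ t, (ξ, t) ∈ D → ∀ p, w ξ t p = g (t + d p * ξ) p + charInt d B w ξ t p)
    {t : ℝ} (ht : (1, t) ∈ D) : charFlow d hB g t = w 1 t := by
  obtain ⟨M, hM, hBM⟩ := exists_mulVec_bound hB
  have hC : 0 ≤ C := (norm_nonneg _).trans (hbd _ _ ht)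
  have key : ∀ K : ℕ, ∀ ξ t, (ξ, t) ∈ D →
      ‖w ξ t - ∑ k ∈ Finset.range K, picardTerm d B g k ξ t‖ ≤
        C * (1 / 2) ^ K * Real.exp (2 * M * ξ) := by
    intro K
    induction K with
    | zero =>
      intro ξ t h
      have hexp : 1 ≤ Real.exp (2 * M * ξ) :=
        Real.one_le_exp (mul_nonneg (by positivity) (hD ξ t h).1)
      simpa using (hbd ξ t h).trans (le_mul_of_one_le_right hC hexp)
    | succ K ih =>
      intro ξ t h
      -- The error of a partial sum is the image under `charInt` of the previous error, so it halves
      -- in the weighted norm.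
      have hstep : w ξ t - ∑ k ∈ Finset.range (K + 1), picardTerm d B g k ξ t =
          charInt d B (fun ξ t => w ξ t - ∑ k ∈ Finset.range K, picardTerm d B g k ξ t) ξ t := by
        funext p
        have hP : ∀ k ∈ Finset.range K, IntervalIntegrable
            (fun η => (B η *ᵥ picardTerm d B g k η (t + d p * (ξ - η))) p) volume 0 ξ :=
          fun k _ => (continuous_charInt_integrand hB (continuous_picardTerm_apply hB g k) ξ t
            p).intervalIntegrable _ _
        -- The term k = 0 is split off, since it is the transported data and cancels against the
        -- data term of w.
        rw [Finset.sum_range_succ', Pi.sub_apply, Pi.add_apply, heq ξ t h p]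
        change g (t + d p * ξ) p + charInt d B w ξ t p - (_ + g (t + d p * ξ) p) = _
        simp only [charInt, Matrix.mulVec_sub, Matrix.mulVec_sum, Pi.sub_apply,
          Finset.sum_apply]
        rw [intervalIntegral.integral_sub (hint ξ t h p) ?_,
          intervalIntegral.integral_finsetSum hP]
        · simp only [picardTerm, charInt]; ring
        · simpa only [Finset.sum_fn] using IntervalIntegrable.sum _ hP
      rw [hstep]
      refine (norm_charInt_le hD hM hBM (by positivity) ih h).trans_eq ?_
      ring
  have hs := (summable_picardTerm (d := d) hB g t).hasSum.tendsto_sum_nat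
  rw [charFlow_apply]
  refine tendsto_nhds_unique hs ?_
  rw [tendsto_iff_norm_sub_tendsto_zero]
  have hz := (summable_geometric_mul C (Real.exp (2 * M * 1))).tendsto_atTop_zero
  refine squeeze_zero (fun _ => norm_nonneg _) (fun K => ?_) hz
  rw [norm_sub_rev]
  exact key K 1 t ht

end CharacteristicFlow

/-! ### Continuous linear operators on signals, integrability of kernel slices, left inverses. -/

section SignalOperators

/-- Pointwise application of a linear map to a signal. -/
def signalMap {ι κ : Type*} [Fintype ι] [Fintype κ] (L : (ι → ℝ) →ₗ[ℝ] (κ → ℝ)) :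
    C(ℝ, ι → ℝ) →L[ℝ] C(ℝ, κ → ℝ) :=
  L.toContinuousLinearMap.compLeftContinuous ℝ ℝ

/-- Stacking two signals. -/
def signalStack (p q : ℕ) : Signal p × Signal q →L[ℝ] C(ℝ, Fin p ⊕ Fin q → ℝ) :=
  signalCLM (fun z t => Sum.elim (z.1 t) (z.2 t))
    (fun x y t => by funext k; cases k <;> rfl) (fun c x t => by funext k; cases k <;> rfl)
    (by
      refine continuous_pi fun k => ?_
      cases k with
      | inl k =>
        have : Continuous fun z : (Signal p × Signal q) × ℝ => z.1.1 z.2 := by fun_prop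
        exact (continuous_apply k).comp this
      | inr k =>
        have : Continuous fun z : (Signal p × Signal q) × ℝ => z.1.2 z.2 := by fun_prop
        exact (continuous_apply k).comp this)

/-- The signal that is held at `y 0` up to time `τ` and is the delayed `y` afterwards. -/
def holdDelay (p : ℕ) (τ : ℝ) : Signal p →L[ℝ] Signal p :=
  signalCLM (fun y t => y (max (t - τ) 0)) (fun _ _ _ => rfl) (fun _ _ _ => rfl) (by fun_prop)

variable {p q : ℕ} {H : ℝ → Matrix (Fin p) (Fin q) ℝ} {c : ℝ}

theorem intervalIntegrable_mulVec_shift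
    (hH : ∀ k l, IntervalIntegrable (fun y => H y k l) volume 0 c) (b : Signal q) (t : ℝ) :
    IntervalIntegrable (fun y => H y *ᵥ b (t - y)) volume 0 c := by
  have key : ∀ k, IntervalIntegrable (fun y => (H y *ᵥ b (t - y)) k) volume 0 c := fun k => by
    have : ∀ l ∈ (Finset.univ : Finset (Fin q)),
        IntervalIntegrable (fun y => H y k l * b (t - y) l) volume 0 c := fun l _ => by
      refine (hH k l).mul_continuousOn (Continuous.continuousOn ?_)
      exact (continuous_apply l).comp (by fun_prop : Continuous fun y => b (t - y))
    have h := IntervalIntegrable.sum _ this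
    rw [Finset.sum_fn] at h
    exact h
  exact ⟨Integrable.of_eval fun k => (key k).1, Integrable.of_eval fun k => (key k).2⟩

/-- Dominated convergence: the kernel is only integrable, and all continuity comes from evaluating
the signal, which is locally bounded uniformly in the signal and the time. -/
theorem continuous_integral_mulVec_shift (hc : 0 ≤ c)
    (hH : ∀ k l, IntervalIntegrable (fun y => H y k l) volume 0 c) :
    Continuous fun z : Signal q × ℝ => ∫ y in (0 : ℝ)..c, H y *ᵥ z.1 (z.2 - y) := by
  refine continuous_iff_continuousAt.2 fun ⟨b₀, t₀⟩ => ?_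
  obtain ⟨C, hC, hb⟩ := exists_bound_Icc b₀ (|t₀| + 1 + c)
  have hW : {g : Signal q | MapsTo g (Icc (-(|t₀| + 1 + c)) (|t₀| + 1 + c)) (Metric.ball 0 C)} ×ˢ
      Metric.ball t₀ 1 ∈ 𝓝 (b₀, t₀) := by
    refine prod_mem_nhds ?_ (Metric.ball_mem_nhds _ one_pos)
    exact (ContinuousMap.isOpen_setOfPred_mapsTo isCompact_Icc Metric.isOpen_ball).mem_nhds
      fun s hs => by simpa using hb s hs
  refine intervalIntegral.continuousAt_of_dominated_interval
    (bound := fun y => ∑ k, ∑ l, |H y k l| * C) ?_ ?_ ?_ ?_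
  · refine Eventually.of_forall fun z => ?_
    exact (intervalIntegrable_iff.1
      (intervalIntegrable_mulVec_shift hH z.1 z.2)).aestronglyMeasurable
  · filter_upwards [hW] with z hz
    refine Eventually.of_forall fun y hy => ?_
    rw [uIoc_of_le hc] at hy
    have h1 : |z.2 - t₀| < 1 := by simpa [Real.dist_eq] using hz.2
    have h2 : ‖z.1 (z.2 - y)‖ ≤ C := by
      refine (mem_ball_zero_iff.1 (hz.1 (abs_le.1 ?_))).le
      have h3 := abs_sub_abs_le_abs_sub z.2 t₀
      have h4 := abs_sub z.2 y
      rw [abs_of_pos hy.1] at h4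
      linarith [hy.2]
    refine (pi_norm_le_iff_of_nonneg
      (Finset.sum_nonneg fun k _ => Finset.sum_nonneg fun l _ => by positivity)).2 fun k => ?_
    refine le_trans ?_ (Finset.single_le_sum (f := fun k => ∑ l, |H y k l| * C)
      (fun k _ => Finset.sum_nonneg fun l _ => by positivity) (Finset.mem_univ k))
    refine (norm_sum_le Finset.univ fun l => H y k l * z.1 (z.2 - y) l).trans
      (Finset.sum_le_sum fun l _ => ?_)
    rw [norm_mul, Real.norm_eq_abs]
    exact mul_le_mul_of_nonneg_left ((norm_le_pi_norm _ l).trans h2) (abs_nonneg _)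
  · have h1 : ∀ k l, IntervalIntegrable (fun y => |H y k l| * C) volume 0 c :=
      fun k l => (hH k l).abs.mul_const C
    have h2 : ∀ k ∈ (Finset.univ : Finset (Fin p)),
        IntervalIntegrable (fun y => ∑ l, |H y k l| * C) volume 0 c := fun k _ => by
      simpa only [Finset.sum_fn] using IntervalIntegrable.sum Finset.univ fun l _ => h1 k l
    simpa only [Finset.sum_fn] using IntervalIntegrable.sum _ h2
  · refine Eventually.of_forall fun y _ => Continuous.continuousAt ?_
    have : Continuous fun z : Signal q × ℝ => z.1 (z.2 - y) := by fun_prop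
    exact continuous_const.matrix_mulVec this

/-- Causal convolution with a matrix kernel on `[0, c]`. -/
def signalConv (hc : 0 ≤ c) (hH : ∀ k l, IntervalIntegrable (fun y => H y k l) volume 0 c) :
    Signal q →L[ℝ] Signal p :=
  signalCLM (fun b t => ∫ y in (0 : ℝ)..c, H y *ᵥ b (t - y))
    (fun b b' t => by
      rw [← intervalIntegral.integral_add (intervalIntegrable_mulVec_shift hH b t)
        (intervalIntegrable_mulVec_shift hH b' t)]
      simp only [ContinuousMap.add_apply, Matrix.mulVec_add])
    (fun a b t => by
      rw [← intervalIntegral.integral_smul]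
      simp only [ContinuousMap.smul_apply, Matrix.mulVec_smul])
    (continuous_integral_mulVec_shift hc hH)

end SignalOperators

/-- A line meets a convex piece in an order-connected set, which is measurable, and there the
function agrees with a continuous one. -/
theorem PiecewiseContinuousOn.intervalIntegrable_slice {f : ℝ × ℝ → ℝ} {D : Set (ℝ × ℝ)}
    (hf : PiecewiseContinuousOn f D) {x c : ℝ} (hc : 0 ≤ c) (hD : ∀ y ∈ Icc 0 c, (x, y) ∈ D) :
    IntervalIntegrable (fun y => f (x, y)) volume 0 c := by
  obtain ⟨r, P, g, hP, hg, hcov, hfg⟩ := hf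
  rw [intervalIntegrable_iff_integrableOn_Icc_of_le hc]
  have hsub : Icc 0 c ⊆ ⋃ j, Icc 0 c ∩ {y | (x, y) ∈ P j} := fun y hy => by
    obtain ⟨j, hj⟩ := mem_iUnion.1 (hcov (hD y hy))
    exact mem_iUnion.2 ⟨j, hy, hj⟩
  refine IntegrableOn.mono_set (integrableOn_finite_iUnion.2 fun j => ?_) hsub
  have hconv : Convex ℝ {y | (x, y) ∈ P j} := by
    intro y hy z hz a b ha hb hab
    have := hP j hy hz ha hb hab
    simp only [Prod.smul_mk, Prod.mk_add_mk, smul_eq_mul, ← add_mul, hab, one_mul] at this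
    exact this
  have hmeas : MeasurableSet (Icc 0 c ∩ {y | (x, y) ∈ P j}) :=
    measurableSet_Icc.inter hconv.ordConnected.measurableSet
  have hgc : Continuous fun y => g j (x, y) := (hg j).comp (by fun_prop)
  exact (hgc.integrableOn_Icc.mono_set inter_subset_left).congr_fun
    (fun y hy => (hfg j (x, y) ⟨hD y hy.1, hy.2⟩).symm) hmeas

/-- Full column rank leaves no kernel, by rank-nullity. -/
theorem exists_leftInverse_of_rank_eq {p q : ℕ} {M : Matrix (Fin p) (Fin q) ℝ} (h : M.rank = q) :
    ∃ L : (Fin p → ℝ) →ₗ[ℝ] (Fin q → ℝ), ∀ x, L (M *ᵥ x) = x := by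
  have hker : LinearMap.ker M.mulVecLin = ⊥ := by
    have := LinearMap.finrank_range_add_finrank_ker M.mulVecLin
    rw [Matrix.rank] at h
    rw [h, Module.finrank_fin_fun] at this
    exact Submodule.finrank_eq_zero.1 (by omega)
  obtain ⟨L, hL⟩ := LinearMap.exists_leftInverse_of_injective _ hker
  exact ⟨L, fun x => congrArg (fun f => f x) hL⟩

/-! ### Domains of dependence for anticipation and for start-up. -/

section Domains

variable {ι : Type*} {d : ι → ℝ} {a b : ℝ}

/-- This domain measures anticipation: from (1, t₀) no characteristic reaches ξ = 0 later than t₀ +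
b. -/
theorem charClosed_lookahead (hb : ∀ p, d p ≤ b) (t₀ : ℝ) :
    CharClosed d {z | 0 ≤ z.1 ∧ z.1 ≤ 1 ∧ z.2 ≤ t₀ + b * (1 - z.1)} := by
  rintro ξ t ⟨h0, h1, h2⟩
  refine ⟨h0, h1, fun p η hη => ⟨hη.1, hη.2.trans h1, ?_⟩⟩
  have := mul_le_mul_of_nonneg_right (hb p) (sub_nonneg.2 hη.2)
  dsimp only at h2 ⊢
  linarith

/-- The lower edge rises with slope a, so data that are valid only from T on suffice at ξ = 1 from T
+ a on. -/
theorem charClosed_strip (ha : ∀ p, -a ≤ d p) (hb : ∀ p, d p ≤ b) (T t₀ : ℝ) :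
    CharClosed d {z | 0 ≤ z.1 ∧ z.1 ≤ 1 ∧ T + a * z.1 ≤ z.2 ∧ z.2 ≤ t₀ + b * (1 - z.1)} := by
  rintro ξ t ⟨h0, h1, h2, h3⟩
  refine ⟨h0, h1, fun p η hη => ⟨hη.1, hη.2.trans h1, ?_, ?_⟩⟩
  · have := mul_le_mul_of_nonneg_right (ha p) (sub_nonneg.2 hη.2)
    dsimp only at h2 ⊢
    linarith
  · have := mul_le_mul_of_nonneg_right (hb p) (sub_nonneg.2 hη.2)
    dsimp only at h3 ⊢
    linarith

end Domains

/-! ### A subsystem as an evolution from x = 1 to x = 0. -/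

namespace ChainSystem

variable (S : ChainSystem)

/-- Slopes `dt/dξ`, `ξ = 1 - x`, of the characteristics traced back to `ξ = 0`. -/
def slope (i : ℕ) (p : S.Idx i) : ℝ := 1 / S.speed i p

/-- The coupling of subsystem `i` in the coordinate `ξ = 1 - x`. -/
def coupling (i : ℕ) (η : ℝ) : Matrix (S.Idx i) (S.Idx i) ℝ :=
  Matrix.of fun p q => -S.slope i p * S.Sig i (projIcc 0 1 zero_le_one (1 - η)) p q

variable {S} {i : ℕ}

theorem lam1_pos (h1 : 1 ≤ i) (hN : i ≤ S.N) : 0 < S.lam1 i := S.lam_pos i h1 hN _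

theorem mu1_pos (h1 : 1 ≤ i) (hN : i ≤ S.N) : 0 < S.mu1 i := S.mu_pos i h1 hN _

theorem slope_le (h1 : 1 ≤ i) (hN : i ≤ S.N) (p : S.Idx i) : S.slope i p ≤ 1 / S.lam1 i := by
  cases p with
  | inl k =>
    exact one_div_le_one_div_of_le (lam1_pos h1 hN)
      ((S.lam_strictMono i h1 hN).monotone (Fin.mk_le_of_le_val (Nat.zero_le _)))
  | inr k =>
    refine le_trans (one_div_nonpos.2 ?_) (one_div_nonneg.2 (lam1_pos h1 hN).le)
    exact neg_nonpos.2 (S.mu_pos i h1 hN k).le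

theorem le_slope (h1 : 1 ≤ i) (hN : i ≤ S.N) (p : S.Idx i) : -(1 / S.mu1 i) ≤ S.slope i p := by
  cases p with
  | inl k =>
    refine le_trans (neg_nonpos.2 (one_div_nonneg.2 (mu1_pos h1 hN).le)) (one_div_nonneg.2 ?_)
    exact (S.lam_pos i h1 hN k).le
  | inr k =>
    change _ ≤ 1 / -S.mu i k
    rw [one_div_neg_eq_neg_one_div]
    exact neg_le_neg (one_div_le_one_div_of_le (mu1_pos h1 hN)
      ((S.mu_strictMono i h1 hN).monotone (Fin.mk_le_of_le_val (Nat.zero_le _))))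

theorem speed_ne_zero (h1 : 1 ≤ i) (hN : i ≤ S.N) (p : S.Idx i) : S.speed i p ≠ 0 := by
  cases p with
  | inl k => exact (S.lam_pos i h1 hN k).ne'
  | inr k => exact neg_ne_zero.2 (S.mu_pos i h1 hN k).ne'

/-- The projection onto [0,1] extends Σ by its end values, which gives the continuity on the whole
line that the flow requires. -/
theorem continuous_coupling (h1 : 1 ≤ i) (hN : i ≤ S.N) : Continuous (S.coupling i) := by
  have hcl : Continuous fun η : ℝ => ((projIcc 0 1 zero_le_one (1 - η) : Icc (0 : ℝ) 1) : ℝ) := by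
    fun_prop
  refine continuous_matrix fun p q => continuous_const.mul ?_
  rcases p with p | p <;> rcases q with q | q
  · exact ((S.Spp_cont i h1 hN).comp_continuous hcl fun η => Subtype.prop _).matrix_elem p q
  · exact ((S.Spm_cont i h1 hN).comp_continuous hcl fun η => Subtype.prop _).matrix_elem p q
  · exact ((S.Smp_cont i h1 hN).comp_continuous hcl fun η => Subtype.prop _).matrix_elem p q
  · exact ((S.Smm_cont i h1 hN).comp_continuous hcl fun η => Subtype.prop _).matrix_elem p q

theorem coupling_mulVec {η : ℝ} (hη : η ∈ Icc (0 : ℝ) 1) (x : S.Idx i → ℝ) (p : S.Idx i) :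
    (S.coupling i η *ᵥ x) p = -S.slope i p * (S.Sig i (1 - η) *ᵥ x) p := by
  have : ((projIcc 0 1 zero_le_one (1 - η) : Icc (0 : ℝ) 1) : ℝ) = 1 - η := by
    rw [projIcc_of_mem _ (⟨by linarith [hη.2], by linarith [hη.1]⟩ : 1 - η ∈ Icc (0 : ℝ) 1)]
  simp only [Matrix.mulVec, dotProduct, coupling, Matrix.of_apply, this, Finset.mul_sum, mul_assoc]

variable {U : ℝ → Fin (S.n 1) → ℝ} {u : (i : ℕ) → ℝ → ℝ → Fin (S.n i) → ℝ}
  {v : (i : ℕ) → ℝ → ℝ → Fin (S.m i) → ℝ}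

variable (u v) in
/-- The state of subsystem `i`, delayed by `τ`, in the coordinate `ξ = 1 - x`. -/
def reflectedState (i : ℕ) (τ ξ t : ℝ) : S.Idx i → ℝ :=
  Sum.elim (u i (t - τ) (1 - ξ)) (v i (t - τ) (1 - ξ))

theorem IsSolution.hasDerivAt_state (hs : S.IsSolution U u v) (h1 : 1 ≤ i) (hN : i ≤ S.N)
    {t x : ℝ} (ht : 0 < t) (hx : x ∈ Ioo (0 : ℝ) 1) (p : S.Idx i) :
    HasDerivAt (fun s => Sum.elim (u i (t + s) (x + S.speed i p * s))
        (v i (t + s) (x + S.speed i p * s)) p)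
      ((S.Sig i x *ᵥ Sum.elim (u i t x) (v i t x)) p) 0 := by
  rw [Sig, Matrix.fromBlocks_mulVec]
  cases p with
  | inl k => exact hs.pde_u i h1 hN t ht x hx k
  | inr k =>
    have h := hs.pde_v i h1 hN t ht x hx k
    simp only [sub_eq_add_neg, ← neg_mul] at h
    exact h

theorem IsSolution.continuousOn_reflectedState (hs : S.IsSolution U u v) (h1 : 1 ≤ i)
    (hN : i ≤ S.N) (τ : ℝ) :
    ContinuousOn (fun z : ℝ × ℝ => reflectedState u v i τ z.1 z.2) (Icc 0 1 ×ˢ Ici τ) := by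
  have hm : MapsTo (fun z : ℝ × ℝ => (z.2 - τ, 1 - z.1)) (Icc 0 1 ×ˢ Ici τ)
      (Ici 0 ×ˢ Icc 0 1) := fun z hz =>
    ⟨mem_Ici.2 (sub_nonneg.2 hz.2), sub_nonneg.2 hz.1.2, sub_le_self _ hz.1.1⟩
  have hu := (hs.cont_u i h1 hN).comp (by fun_prop) hm
  have hv := (hs.cont_v i h1 hN).comp (by fun_prop) hm
  refine continuousOn_pi.2 fun p => ?_
  cases p with
  | inl k => exact (continuous_apply k).comp_continuousOn hu
  | inr k => exact (continuous_apply k).comp_continuousOn hv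

theorem IsSolution.continuousOn_characteristic (hs : S.IsSolution U u v) (h1 : 1 ≤ i)
    (hN : i ≤ S.N) {τ ξ t : ℝ} (hξ1 : ξ ≤ 1) {d : ℝ}
    (ht : ∀ η ∈ Icc 0 ξ, τ ≤ t + d * (ξ - η)) :
    ContinuousOn (fun η => reflectedState u v i τ η (t + d * (ξ - η))) (Icc 0 ξ) :=
  (hs.continuousOn_reflectedState h1 hN τ).comp
    (f := fun η => (η, t + d * (ξ - η))) (by fun_prop)
    fun η hη => ⟨⟨hη.1, hη.2.trans hξ1⟩, ht η hη⟩

/-- Solutions satisfy the integral equation along characteristics traced back to `x = 1`. -/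
theorem IsSolution.reflectedState_eq (hs : S.IsSolution U u v) (h1 : 1 ≤ i) (hN : i ≤ S.N)
    {τ ξ t : ℝ} (hξ0 : 0 ≤ ξ) (hξ1 : ξ ≤ 1) (p : S.Idx i)
    (ht : ∀ η ∈ Icc 0 ξ, τ ≤ t + S.slope i p * (ξ - η)) :
    IntervalIntegrable (fun η => (S.coupling i η *ᵥ
        reflectedState u v i τ η (t + S.slope i p * (ξ - η))) p) volume 0 ξ ∧
      reflectedState u v i τ ξ t p = reflectedState u v i τ 0 (t + S.slope i p * ξ) p +
        charInt (S.slope i) (S.coupling i) (reflectedState u v i τ) ξ t p := by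
  have hd : S.slope i p ≠ 0 := one_div_ne_zero (speed_ne_zero h1 hN p)
  have hsd : S.speed i p * S.slope i p = 1 := mul_one_div_cancel (speed_ne_zero h1 hN p)
  set d := S.slope i p with hdef
  have hc := hs.continuousOn_characteristic h1 hN hξ1 ht
  have hcont : ContinuousOn (fun η => (S.coupling i η *ᵥ
      reflectedState u v i τ η (t + d * (ξ - η))) p) (Icc 0 ξ) := by
    rw [continuousOn_iff_continuous_domRestrict] at hc ⊢
    exact (continuous_apply p).comp
      (((continuous_coupling h1 hN).comp continuous_subtype_val).matrix_mulVec hc)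
  have hint := hcont.intervalIntegrable_of_Icc hξ0 (μ := volume)
  refine ⟨hint, ?_⟩
  have hftc := intervalIntegral.integral_eq_sub_of_hasDerivAt_of_le hξ0
    ((continuous_apply p).comp_continuousOn hc) (fun η hη => ?_) hint
  · change (charInt (S.slope i) (S.coupling i) (reflectedState u v i τ) ξ t p) = _ at hftc
    rw [hftc]
    simp
  -- The PDE holds at positive times only. Both ends of the characteristic have nonnegative delayed
  -- time, and time is strictly monotone along it, so interior times are positive.
  · have hpos : 0 < t + d * (ξ - η) - τ := by
      have e0 := ht 0 ⟨le_rfl, hξ0⟩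
      have e1 := ht ξ ⟨hξ0, le_rfl⟩
      rcases lt_or_gt_of_ne hd with h | h
      · nlinarith [mul_pos_of_neg_of_neg h (neg_lt_zero.2 hη.1)]
      · nlinarith [mul_pos h (sub_pos.2 hη.2)]
    have hη1 : 1 - η ∈ Ioo (0 : ℝ) 1 := ⟨by linarith [hη.2], by linarith [hη.1]⟩
    have hder := hs.hasDerivAt_state h1 hN hpos hη1 p
    -- The PDE differentiates with respect to time; passing to the parameter η rescales by -d, the
    -- factor in `coupling`.
    have hlin : HasDerivAt (fun r => -d * (r - η)) (-d) η := by
      simpa using ((hasDerivAt_id η).sub_const η).const_mul (-d)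
    have h0 : (0 : ℝ) = -d * (η - η) := by simp
    rw [h0] at hder
    have hcomp := hder.comp η hlin
    rw [coupling_mulVec ⟨hη.1.le, hη.2.le.trans hξ1⟩, mul_comm]
    refine (hcomp.congr_of_eventuallyEq (Eventually.of_forall fun r => ?_)).congr_deriv rfl
    have e1 : t + d * (ξ - η) - τ + -d * (r - η) = t + d * (ξ - r) - τ := by ring
    have e2 : 1 - η + S.speed i p * (-d * (r - η)) = 1 - r := by
      linear_combination (η - r) * hsd
    simp only [Function.comp, e1, e2, reflectedState]

/-- The flow in the direction of decreasing `x`, applied to boundary data that agree with the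
solution from time `T` on, recovers the state at `x = 0` from time `T + 1 / μ_i^1` on. -/
theorem IsSolution.charFlow_eq (hs : S.IsSolution U u v) (h1 : 1 ≤ i) (hN : i ≤ S.N)
    {τ T : ℝ} (hT : τ ≤ T) {g : C(ℝ, S.Idx i → ℝ)}
    (hg : ∀ s, T ≤ s → g s = Sum.elim (u i (s - τ) 1) (v i (s - τ) 1))
    {s : ℝ} (hsT : T + 1 / S.mu1 i ≤ s) :
    charFlow (S.slope i) (continuous_coupling h1 hN) g s =
      Sum.elim (u i (s - τ) 0) (v i (s - τ) 0) := by
  -- The strip lies in t ≥ T, so the data are used only where they are exact and the solution only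
  -- at times t ≥ τ. Its lower edge reaches T + 1/μ¹ ≤ s at ξ = 1.
  have hD := charClosed_strip (le_slope h1 hN) (slope_le h1 hN) T s
  set D : Set (ℝ × ℝ) := {z | 0 ≤ z.1 ∧ z.1 ≤ 1 ∧ T + 1 / S.mu1 i * z.1 ≤ z.2 ∧
    z.2 ≤ s + 1 / S.lam1 i * (1 - z.1)} with hDdef
  have ha : 0 < 1 / S.mu1 i := one_div_pos.2 (mu1_pos h1 hN)
  have hb : 0 < 1 / S.lam1 i := one_div_pos.2 (lam1_pos h1 hN)
  have hmem : ∀ ξ t, (ξ, t) ∈ D → T ≤ t := fun ξ t h => by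
    have h2 := h.2.2.1
    have := mul_nonneg ha.le h.1
    dsimp only at *
    linarith
  have hsub : D ⊆ Icc 0 1 ×ˢ Icc τ (s + 1 / S.lam1 i) := fun z h =>
    ⟨⟨h.1, h.2.1⟩, hT.trans (hmem z.1 z.2 h), by
      have h2 := h.2.2.2
      have := mul_nonneg hb.le h.1
      linarith⟩
  have hcw := (hs.continuousOn_reflectedState h1 hN τ).mono
    (t := Icc 0 1 ×ˢ Icc τ (s + 1 / S.lam1 i)) (prod_mono le_rfl Icc_subset_Ici_self)
  obtain ⟨C, hC⟩ := (isCompact_Icc.prod isCompact_Icc).exists_bound_of_continuousOn hcw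
  have hs1 : ((1 : ℝ), s) ∈ D := ⟨zero_le_one, le_rfl, by simpa using hsT, by simp⟩
  have hchar : ∀ ξ t, (ξ, t) ∈ D → ∀ p, ∀ η ∈ Icc 0 ξ, τ ≤ t + S.slope i p * (ξ - η) :=
    fun ξ t h p η hη => hT.trans (hmem _ _ ((hD ξ t h).2.2 p η hη))
  have := charFlow_eq_of_integral_eq (continuous_coupling h1 hN) hD (g := g)
    (w := reflectedState u v i τ) (C := C) (fun ξ t h => hC _ (hsub h))
    (fun ξ t h p => (hs.reflectedState_eq h1 hN h.1 h.2.1 p (hchar ξ t h p)).1)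
    (fun ξ t h p => by
      rw [(hs.reflectedState_eq h1 hN h.1 h.2.1 p (hchar ξ t h p)).2]
      have h0 := (hD ξ t h).2.2 p 0 ⟨le_rfl, h.1⟩
      rw [sub_zero] at h0
      rw [hg _ (hmem _ _ h0)]
      simp [reflectedState]) hs1
  rw [this]
  simp [reflectedState]

end ChainSystem

/-! ### The recursion step between neighbouring subsystems. -/

namespace ChainSystem

variable {S : ChainSystem} {i : ℕ}

theorem Kernels.IsBackstepping.intervalIntegrable_F {κ : S.Kernels} (hκ : κ.IsBackstepping i)
    (h1 : 1 ≤ i) (hN : i ≤ S.N) (k : Fin (S.n i)) (l : Fin (S.m (i + 1))) :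
    IntervalIntegrable (fun y => κ.F i 1 y k l) volume 0 (1 / S.lam1 i) :=
  (hκ.pc_F k l).intervalIntegrable_slice (one_div_nonneg.2 (lam1_pos h1 hN).le)
    fun _ hy => ⟨⟨zero_le_one, le_rfl⟩, hy.1, hy.2⟩

/-- The contribution of `v_{i+1}(·,0)` to `α_i(·,1)`. -/
def driftOp (κ : S.Kernels) (hκ : κ.IsBackstepping i) (h1 : 1 ≤ i) (hN : i ≤ S.N) :
    Signal (S.m (i + 1)) →L[ℝ] Signal (S.n i) :=
  signalConv (one_div_nonneg.2 (lam1_pos h1 hN).le) (hκ.intervalIntegrable_F h1 hN)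

theorem driftOp_apply (κ : S.Kernels) (hκ : κ.IsBackstepping i) (h1 : 1 ≤ i) (hN : i ≤ S.N)
    (b : Signal (S.m (i + 1))) (t : ℝ) :
    driftOp κ hκ h1 hN b t = ∫ y in (0 : ℝ)..(1 / S.lam1 i), κ.F i 1 y *ᵥ b (t - y) := rfl

theorem driftOp_congr (κ : S.Kernels) (hκ : κ.IsBackstepping i) (h1 : 1 ≤ i) (hN : i ≤ S.N)
    {b b' : Signal (S.m (i + 1))} {t : ℝ} (h : ∀ r ≤ t, b r = b' r) :
    driftOp κ hκ h1 hN b t = driftOp κ hκ h1 hN b' t := by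
  rw [driftOp_apply, driftOp_apply]
  refine intervalIntegral.integral_congr fun y hy => ?_
  rw [uIcc_of_le (one_div_nonneg.2 (lam1_pos h1 hN).le)] at hy
  simp only [h (t - y) (by linarith [hy.1])]

/-- The boundary data at `x = 1` of subsystem `i` from the signals `α_i(·,1)`, `v_{i+1}(·,0)`. -/
def boundaryData (κ : S.Kernels) (hκ : κ.IsBackstepping i) (h1 : 1 ≤ i) (hN : i ≤ S.N) :
    Signal (S.n i) × Signal (S.m (i + 1)) →L[ℝ] C(ℝ, S.Idx i → ℝ) :=
  let X := ContinuousLinearMap.fst ℝ (Signal (S.n i)) (Signal (S.m (i + 1))) -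
    (driftOp κ hκ h1 hN).comp (ContinuousLinearMap.snd ℝ _ _)
  (signalStack _ _).comp (X.prod ((signalMap (S.R i).mulVecLin).comp X +
    (signalMap (S.Rdown i).mulVecLin).comp (ContinuousLinearMap.snd ℝ _ _)))

theorem boundaryData_apply (κ : S.Kernels) (hκ : κ.IsBackstepping i) (h1 : 1 ≤ i) (hN : i ≤ S.N)
    (a : Signal (S.n i)) (b : Signal (S.m (i + 1))) (t : ℝ) :
    boundaryData κ hκ h1 hN (a, b) t = Sum.elim (a t - driftOp κ hκ h1 hN b t)
      (S.R i *ᵥ (a t - driftOp κ hκ h1 hN b t) + S.Rdown i *ᵥ b t) := rfl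

/-- The state at `x = 0` of subsystem `i` from the signals `α_i(·,1)`, `v_{i+1}(·,0)`. -/
def inletState (κ : S.Kernels) (hκ : κ.IsBackstepping i) (h1 : 1 ≤ i) (hN : i ≤ S.N) :
    Signal (S.n i) × Signal (S.m (i + 1)) →L[ℝ] C(ℝ, S.Idx i → ℝ) :=
  (charFlow (S.slope i) (continuous_coupling h1 hN)).comp (boundaryData κ hκ h1 hN)

/-- The flow looks ahead by the largest slope 1/λ¹, and forming the boundary data adds nothing
because the convolution is causal. -/
theorem inletState_congr (κ : S.Kernels) (hκ : κ.IsBackstepping i) (h1 : 1 ≤ i) (hN : i ≤ S.N)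
    {a a' : Signal (S.n i)} {b b' : Signal (S.m (i + 1))} {s : ℝ}
    (h : ∀ r ≤ s + 1 / S.lam1 i, a r = a' r ∧ b r = b' r) :
    inletState κ hκ h1 hN (a, b) s = inletState κ hκ h1 hN (a', b') s := by
  refine charFlow_congr (continuous_coupling h1 hN) (charClosed_lookahead (slope_le h1 hN) s)
    (fun r hr => ?_) ⟨zero_le_one, le_rfl, by simp⟩
  have hr' : r ≤ s + 1 / S.lam1 i := by simpa using hr.2.2
  change boundaryData κ hκ h1 hN (a, b) r = boundaryData κ hκ h1 hN (a', b') r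
  rw [boundaryData_apply, boundaryData_apply, (h r hr').1, (h r hr').2,
    driftOp_congr κ hκ h1 hN fun q hq => (h q (hq.trans hr')).2]

/-- The signals `α_i(·,1)`, `v_{i+1}(·,0)` from a left inverse `L` of `Q_{i+1,i}` and the state of
subsystem `i + 1` at `x = 0`. -/
def upstreamSignals (κ : S.Kernels) (hκ : κ.IsBackstepping i) (h1 : 1 ≤ i) (hN : i ≤ S.N)
    (L : (Fin (S.n (i + 1)) → ℝ) →ₗ[ℝ] (Fin (S.n i) → ℝ)) :
    C(ℝ, S.Idx (i + 1) → ℝ) →L[ℝ] Signal (S.n i) × Signal (S.m (i + 1)) :=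
  let X := signalMap (LinearMap.funLeft ℝ ℝ (Sum.inl : _ → S.Idx (i + 1)))
  let Y := signalMap (LinearMap.funLeft ℝ ℝ (Sum.inr : _ → S.Idx (i + 1)))
  ((signalMap L).comp (X - (signalMap (S.Q (i + 1)).mulVecLin).comp Y) +
    (driftOp κ hκ h1 hN).comp Y).prod Y

theorem upstreamSignals_snd (κ : S.Kernels) (hκ : κ.IsBackstepping i) (h1 : 1 ≤ i) (hN : i ≤ S.N)
    (L : (Fin (S.n (i + 1)) → ℝ) →ₗ[ℝ] (Fin (S.n i) → ℝ)) (w : C(ℝ, S.Idx (i + 1) → ℝ)) (t : ℝ) :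
    (upstreamSignals κ hκ h1 hN L w).2 t = w t ∘ Sum.inr := rfl

theorem upstreamSignals_fst (κ : S.Kernels) (hκ : κ.IsBackstepping i) (h1 : 1 ≤ i) (hN : i ≤ S.N)
    (L : (Fin (S.n (i + 1)) → ℝ) →ₗ[ℝ] (Fin (S.n i) → ℝ)) (w : C(ℝ, S.Idx (i + 1) → ℝ)) (t : ℝ) :
    (upstreamSignals κ hκ h1 hN L w).1 t =
      L (w t ∘ Sum.inl - S.Q (i + 1) *ᵥ (w t ∘ Sum.inr)) +
        driftOp κ hκ h1 hN (upstreamSignals κ hκ h1 hN L w).2 t := rfl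

/-- `a` and `b` are, from time `T` on, the delayed signals `α_i(·,1)` and `v_{i+1}(·,0)`, where the
values of `v_{i+1}(·,0)` in the definition of `α_i(·,1)` are taken from `b`. -/
def Tracks (κ : S.Kernels) (u : (i : ℕ) → ℝ → ℝ → Fin (S.n i) → ℝ)
    (v : (i : ℕ) → ℝ → ℝ → Fin (S.m i) → ℝ) (i : ℕ) (τ T : ℝ)
    (z : Signal (S.n i) × Signal (S.m (i + 1))) : Prop :=
  ∀ s, T ≤ s →
    z.1 s = u i (s - τ) 1 + (∫ y in (0 : ℝ)..(1 / S.lam1 i), κ.F i 1 y *ᵥ z.2 (s - y)) ∧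
      z.2 s = S.vNext v i (s - τ)

theorem Tracks.fst_eq_alpha {κ : S.Kernels} {u : (i : ℕ) → ℝ → ℝ → Fin (S.n i) → ℝ}
    {v : (i : ℕ) → ℝ → ℝ → Fin (S.m i) → ℝ} (h1 : 1 ≤ i) (hN : i ≤ S.N) {τ T : ℝ}
    {z : Signal (S.n i) × Signal (S.m (i + 1))} (h : Tracks κ u v i τ T z) {s : ℝ}
    (hs : T + 1 / S.lam1 i ≤ s) : z.1 s = κ.alpha u v i (s - τ) 1 := by
  have hb : 0 < 1 / S.lam1 i := one_div_pos.2 (lam1_pos h1 hN)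
  rw [(h s (by linarith)).1, Kernels.alpha, intervalIntegral.integral_same, add_zero]
  congr 1
  refine intervalIntegral.integral_congr fun y hy => ?_
  rw [uIcc_of_le hb.le] at hy
  have := (h (s - y) (by linarith [hy.2])).2
  simp only [this, sub_right_comm]

/-- One step of the recursion, from subsystem `i + 1` to subsystem `i`. -/
theorem exists_recursion_step (κ : S.Kernels) (hκ : ∀ i, 1 ≤ i → i ≤ S.N → κ.IsBackstepping i)
    (h1 : 1 ≤ i) (hN : i < S.N) (hQ : (S.Qup i).rank = S.n i) :
    ∃ Φ : (Signal (S.n (i + 1)) × Signal (S.m (i + 1 + 1))) →L[ℝ]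
        (Signal (S.n i) × Signal (S.m (i + 1))),
      HasLookahead Φ (1 / S.lam1 (i + 1)) ∧
      ∀ U u v, S.IsSolution U u v → ∀ τ T, τ ≤ T → ∀ z, Tracks κ u v (i + 1) τ T z →
        Tracks κ u v i τ (T + 1 / S.mu1 (i + 1)) (Φ z) := by
  obtain ⟨L, hL⟩ := exists_leftInverse_of_rank_eq hQ
  have h1' : 1 ≤ i + 1 := by omega
  have hκi := hκ i h1 hN.le
  have hκj := hκ (i + 1) h1' hN
  refine ⟨(upstreamSignals κ hκi h1 hN.le L).comp (inletState κ hκj h1' hN),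
    fun s a a' b b' h => ?_, fun U u v hs τ T hT z hz s hsT => ?_⟩
  -- All earlier times are needed too, since the convolution for subsystem i reads the past of the
  -- new second component.
  · have hw : ∀ r ≤ s, inletState κ hκj h1' hN (a, b) r = inletState κ hκj h1' hN (a', b') r :=
      fun r hr => inletState_congr κ hκj h1' hN fun q hq => h q (by linarith)
    simp only [ContinuousLinearMap.comp_apply]
    refine ⟨?_, by rw [upstreamSignals_snd, upstreamSignals_snd, hw s le_rfl]⟩
    rw [upstreamSignals_fst, upstreamSignals_fst, hw s le_rfl]
    congr 1
    refine driftOp_congr κ hκi h1 hN.le fun r hr => ?_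
    rw [upstreamSignals_snd, upstreamSignals_snd, hw r hr]
  · have hg : ∀ r, T ≤ r → boundaryData κ hκj h1' hN z r =
        Sum.elim (u (i + 1) (r - τ) 1) (v (i + 1) (r - τ) 1) := fun r hr => by
      obtain ⟨a, b⟩ := z
      -- The convolution contained in a uses this same b, so it cancels even where it reads values
      -- of b before T.
      have hu : a r - driftOp κ hκj h1' hN b r = u (i + 1) (r - τ) 1 :=
        sub_eq_iff_eq_add.2 (hz r hr).1
      rw [boundaryData_apply, hu, hs.bc_v (i + 1) h1' hN (r - τ) (by linarith),
        ← (hz r hr).2]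
    have hτ : 0 ≤ s - τ := by
      have := one_div_pos.2 (mu1_pos (S := S) h1' hN)
      linarith
    have hw : inletState κ hκj h1' hN z s =
        Sum.elim (u (i + 1) (s - τ) 0) (v (i + 1) (s - τ) 0) :=
      hs.charFlow_eq h1' hN hT hg hsT
    simp only [ContinuousLinearMap.comp_apply]
    refine ⟨?_, by rw [upstreamSignals_snd, hw, vNext, if_pos hN]; rfl⟩
    -- In the coupling condition at x = 0, removing the reflection term leaves Q_{i+1,i} u_i(·,1),
    -- which L inverts.
    rw [upstreamSignals_fst, hw, Sum.elim_comp_inl, Sum.elim_comp_inr,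
      hs.bc_u i h1 hN (s - τ) hτ, add_sub_cancel_left, hL]
    rfl

end ChainSystem

/-! ### Downward recursion and bookkeeping of the time windows. -/

/-- Dependent recursion from `N` down to `0`. -/
theorem exists_downward_recursion {β : ℕ → Type*} [∀ i, Inhabited (β i)] (N : ℕ) (e : β N)
    (step : ∀ i, β (i + 1) → β i) :
    ∃ f : ∀ i, β i, f N = e ∧ ∀ i < N, f i = step i (f (i + 1)) := by
  induction N generalizing β with
  | zero =>
    exact ⟨fun i => match i with
      | 0 => e
      | _ + 1 => default, rfl, fun i hi => absurd hi (Nat.not_lt_zero i)⟩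
  | succ N ih =>
    -- Shifting the family by one keeps the prescribed value at the top; index 0 is then added by
    -- one further step.
    obtain ⟨f, hf, hstep⟩ := ih (β := fun i => β (i + 1)) e fun i => step (i + 1)
    refine ⟨fun i => match i with
      | 0 => step 0 (f 0)
      | i + 1 => f i, hf, fun i hi => ?_⟩
    cases i with
    | zero => rfl
    | succ i => exact hstep i (by omega)

theorem sum_Ioc_eq_add {M : Type*} [AddCommMonoid M] (f : ℕ → M) {i N : ℕ} (h : i < N) :
    ∑ j ∈ Finset.Ioc i N, f j = f (i + 1) + ∑ j ∈ Finset.Ioc (i + 1) N, f j := by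
  rw [← Finset.insert_Ioc_add_one_left_eq_Ioc h, Finset.sum_insert (by simp)]

end

theorem lemma1 (S : ChainSystem)
    (hQ : ∀ i, 1 ≤ i → i < S.N → (S.Qup i).rank = S.n i)
    (κ : S.Kernels) (hκ : ∀ i, 1 ≤ i → i ≤ S.N → κ.IsBackstepping i)
    (τ : ℝ) (hτ : ∑ j ∈ Finset.Icc 1 S.N, 1 / S.lam1 j < τ) :
    ∃ (A : (i : ℕ) → Signal (S.n S.N) →L[ℝ] Signal (S.n i))
      (V : (i : ℕ) → Signal (S.n S.N) →L[ℝ] Signal (S.m i)),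
      -- the estimators are causal in the measurement and exact
      (∀ i, 1 ≤ i → i ≤ S.N →
        CausalOnWindow (A i) (∑ j ∈ Finset.Icc 1 i, 1 / S.lam1 j) ∧
        CausalOnWindow (V (i + 1)) (∑ j ∈ Finset.Icc 1 i, 1 / S.lam1 j) ∧
        ∀ (U : ℝ → Fin (S.n 1) → ℝ) (u : (i : ℕ) → ℝ → ℝ → Fin (S.n i) → ℝ)
          (v : (i : ℕ) → ℝ → ℝ → Fin (S.m i) → ℝ), S.IsSolution U u v →
          ∀ y : Signal (S.n S.N), (∀ t, 0 ≤ t → y t = u S.N t 1) →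
          ∀ t, 0 ≤ t → ∀ ν ∈ Set.Icc 0 (∑ j ∈ Finset.Icc 1 i, 1 / S.lam1 j),
            (τ + 1 / S.lam1 i + ∑ j ∈ Finset.Ioc i S.N, 1 / S.mu1 j ≤ t + ν →
              A i y (t + ν) = delayed τ (fun s => κ.alpha u v i s 1) (t + ν)) ∧
            (τ + ∑ j ∈ Finset.Ioc i S.N, 1 / S.mu1 j ≤ t + ν →
              V (i + 1) y (t + ν) = delayed τ (S.vNext v i) (t + ν))) ∧
      -- they are built recursively, from subsystem `N` back to subsystem `1`
      (∀ y, ∀ s, τ ≤ s → A S.N y s = delayed τ y s) ∧ V (S.N + 1) = 0 ∧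
      ∀ i, 1 ≤ i → i < S.N →
        ∃ Φ : (Signal (S.n (i + 1)) × Signal (S.m (i + 2))) →L[ℝ]
            (Signal (S.n i) × Signal (S.m (i + 1))),
          HasLookahead Φ (1 / S.lam1 (i + 1)) ∧
          ∀ y, (A i y, V (i + 1) y) = Φ (A (i + 1) y, V (i + 2) y) := by
  classical
  have hstep : ∀ i, 1 ≤ i → i < S.N → _ := fun i h1 hN =>
    ChainSystem.exists_recursion_step κ hκ h1 hN (hQ i h1 hN)
  let Φ : (i : ℕ) → (Signal (S.n (i + 1)) × Signal (S.m (i + 1 + 1))) →L[ℝ]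
      (Signal (S.n i) × Signal (S.m (i + 1))) := fun i =>
    if h : 1 ≤ i ∧ i < S.N then (hstep i h.1 h.2).choose else 0
  have hΦ : ∀ i (h1 : 1 ≤ i) (hN : i < S.N), Φ i = (hstep i h1 hN).choose := fun i h1 hN =>
    dif_pos ⟨h1, hN⟩
  have hlook : ∀ i, 1 ≤ i → i < S.N → HasLookahead (Φ i) (1 / S.lam1 (i + 1)) :=
    fun i h1 hN => by rw [hΦ i h1 hN]; exact (hstep i h1 hN).choose_spec.1
  have htrack : ∀ i, 1 ≤ i → i < S.N → ∀ U u v, S.IsSolution U u v → ∀ τ T, τ ≤ T → ∀ z,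
      ChainSystem.Tracks κ u v (i + 1) τ T z →
        ChainSystem.Tracks κ u v i τ (T + 1 / S.mu1 (i + 1)) (Φ i z) :=
    fun i h1 hN => by rw [hΦ i h1 hN]; exact (hstep i h1 hN).choose_spec.2
  -- The recursion starts with the delayed measurement and zero, since v_{N+1}(·,0) = 0 makes
  -- α_N(·,1) equal to u_N(·,1). Holding y at y(0) makes the start independent of y at negative
  -- times.
  obtain ⟨E, hEN, hErec⟩ := exists_downward_recursion
    (β := fun i => Signal (S.n S.N) →L[ℝ] Signal (S.n i) × Signal (S.m (i + 1))) S.N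
    ((holdDelay (S.n S.N) τ).prod 0) fun i e => (Φ i).comp e
  -- The reach is the delay reduced by the lookaheads of subsystems i+1 to N; the maximum with 0
  -- accounts for the held value y(0).
  have hcausal : ∀ i, 1 ≤ i → i ≤ S.N → ∀ (y y' : Signal (S.n S.N)) (s : ℝ),
      (∀ r ∈ Icc 0 (max 0 (s - τ + ∑ j ∈ Finset.Ioc i S.N, 1 / S.lam1 j)), y r = y' r) →
      (E i y).1 s = (E i y').1 s ∧ (E i y).2 s = (E i y').2 s := by
    intro i h1 hN
    refine Nat.decreasingInduction' (P := fun i => ∀ (y y' : Signal (S.n S.N)) (s : ℝ),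
      (∀ r ∈ Icc 0 (max 0 (s - τ + ∑ j ∈ Finset.Ioc i S.N, 1 / S.lam1 j)), y r = y' r) →
      (E i y).1 s = (E i y').1 s ∧ (E i y).2 s = (E i y').2 s)
      (fun k hk hik ih y y' s h => ?_) hN (fun y y' s h => ?_)
    · rw [hErec k hk]
      refine hlook k (h1.trans hik) hk s _ _ _ _ fun r hr => ih y y' r fun q hq => h q ?_
      refine ⟨hq.1, hq.2.trans (max_le_max le_rfl ?_)⟩
      rw [sum_Ioc_eq_add _ hk]
      linarith
    · rw [hEN]
      refine ⟨h _ ⟨le_max_right _ _, ?_⟩, rfl⟩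
      simp [max_comm]
  -- The lookaheads for j > i and the window for j ≤ i together form the full sum, which is less
  -- than τ.
  have hwindow : ∀ i, i ≤ S.N → ∀ t, 0 ≤ t →
      ∀ ν ∈ Icc 0 (∑ j ∈ Finset.Icc 1 i, 1 / S.lam1 j),
      max 0 (t + ν - τ + ∑ j ∈ Finset.Ioc i S.N, 1 / S.lam1 j) ≤ t := by
    intro i hN t ht ν hν
    have hsplit := Finset.sum_Ioc_consecutive (fun j => 1 / S.lam1 j) (Nat.zero_le i) hN
    have hν' : ν ≤ ∑ j ∈ Finset.Ioc 0 i, 1 / S.lam1 j := hν.2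
    have hτ' : ∑ j ∈ Finset.Ioc 0 S.N, 1 / S.lam1 j < τ := hτ
    exact max_le ht (by linarith)
  have hexact : ∀ U u v, S.IsSolution U u v → ∀ y : Signal (S.n S.N),
      (∀ t, 0 ≤ t → y t = u S.N t 1) → ∀ i, 1 ≤ i → i ≤ S.N →
      ChainSystem.Tracks κ u v i τ (τ + ∑ j ∈ Finset.Ioc i S.N, 1 / S.mu1 j) (E i y) := by
    intro U u v hs y hy i h1 hN
    refine Nat.decreasingInduction' (P := fun i =>
      ChainSystem.Tracks κ u v i τ (τ + ∑ j ∈ Finset.Ioc i S.N, 1 / S.mu1 j) (E i y))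
      (fun k hk hik ih => ?_) hN ?_
    · have hT : τ ≤ τ + ∑ j ∈ Finset.Ioc (k + 1) S.N, 1 / S.mu1 j := by
        refine le_add_of_nonneg_right (Finset.sum_nonneg fun j hj => ?_)
        rw [Finset.mem_Ioc] at hj
        exact one_div_nonneg.2 (ChainSystem.mu1_pos (by omega) hj.2).le
      have := htrack k (h1.trans hik) hk U u v hs τ _ hT _ ih
      rw [hErec k hk, sum_Ioc_eq_add _ hk, add_comm (1 / S.mu1 (k + 1)), ← add_assoc]
      exact this
    · intro s hsT
      have hsτ : τ ≤ s := by simpa using hsT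
      rw [hEN]
      constructor
      · change y (max (s - τ) 0) = _
        rw [max_eq_left (sub_nonneg.2 hsτ), hy _ (sub_nonneg.2 hsτ)]
        simp
      · simp [ChainSystem.vNext]
  refine ⟨fun i => (ContinuousLinearMap.fst ℝ _ _).comp (E i), fun i => match i with
    | 0 => 0
    | i + 1 => (ContinuousLinearMap.snd ℝ _ _).comp (E i), fun i h1 hN => ⟨?_, ?_, ?_⟩,
    fun y s hs => ?_, ?_, fun i h1 hN => ⟨Φ i, hlook i h1 hN, fun y => ?_⟩⟩
  · exact fun t ht y y' h ν hν => (hcausal i h1 hN y y' (t + ν) fun r hr =>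
      h r ⟨hr.1, hr.2.trans (hwindow i hN t ht ν hν)⟩).1
  · exact fun t ht y y' h ν hν => (hcausal i h1 hN y y' (t + ν) fun r hr =>
      h r ⟨hr.1, hr.2.trans (hwindow i hN t ht ν hν)⟩).2
  · intro U u v hs y hy t _ ν _
    have htr := hexact U u v hs y hy i h1 hN
    exact ⟨fun h => htr.fst_eq_alpha h1 hN (by linarith), fun h => (htr _ h).2⟩
  · change (E S.N y).1 s = _
    rw [hEN]
    change y (max (s - τ) 0) = _
    rw [max_eq_left (sub_nonneg.2 hs)]
    rfl
  · change (ContinuousLinearMap.snd ℝ _ _).comp (E S.N) = 0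
    rw [hEN]
    rfl
  · change E i y = Φ i (E (i + 1) y)
    rw [hErec i hN]
    rfl
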